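/- Theorem. Let $D\ge 0$. There is a constant $\mu>0$, depending only on $D$, and for every time $t\in\mathbb{R}$ a constant $K\ge 0$, depending only on $D$ and $t$, such that the following holds. Let $\Gamma\subset\mathbb{Z}^D$ be finite, let every site of $\Gamma$ carry a copy of $\mathbb{C}^q$ with $q\ge 1$ ($q=2$ for qubits), and let $H=\sum_{X\subseteq\Gamma}H_X$ be a geometrically local Hamiltonian on $\bigotimes_{x\in\Gamma}\mathbb{C}^q$: every $H_X$ is Hermitian, is supported on $X$ (it acts as the identity on $\Gamma\setminus X$), satisfies $\|H_X\|\le 1$, and vanishes if $\mathrm{diam}(X)>1$. Here $\|\cdot\|$ is the spectral norm, $\mathrm{dist}(x,y)=\sum_i|x_i-y_i|$ is the graph distance of $\mathbb{Z}^D$, $\mathrm{diam}(X)=\max_{x,x'\in X}\mathrm{dist}(x,x')$ and $\mathrm{dist}(A,C)=\min_{a\in A,\,c\in C}\mathrm{dist}(a,c)$. For $S\subseteq\Gamma$ put $U_S=e^{-it\sum_{X\subseteq S}H_X}$, $\mathcal{U}_S(\rho)=U_S\,\rho\,U_S^\dagger$ and $\mathcal{U}_S^\dagger(\rho)=U_S^\dagger\,\rho\,U_S$.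 Then for all pairwise disjoint regions $A,B,C\subseteq\Gamma$ with $A$ and $C$ nonempty, $$\bigl\|\mathcal{U}_{A\cup B}\circ\mathcal{U}_B^\dagger\circ\mathcal{U}_{B\cup C}-\mathcal{U}_{A\cup B\cup C}\bigr\|_{1\to\infty}\;\le\;K\,e^{-\mu\,\mathrm{dist}(A,C)}\sum_{X:\,bd(AB,C)}\|H_X\|,$$ where $\|\Phi\|_{1\to\infty}=\max_{\|\rho\|_1\le 1}\|\Phi(\rho)\|$ is the induced norm from the trace norm $\|\cdot\|_1$ to the spectral norm (the maximum is over all complex matrices $\rho$ with $\|\rho\|_1\le1$), and $X:bd(AB,C)$ means $X\subseteq A\cup B\cup C$, $X\not\subseteq A\cup B$ and $X\not\subseteq C$. -/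

import Mathlib

open scoped Matrix Matrix.Norms.L2Operator

namespace LocalDecomp

/-! ### Norms of matrices and of superoperators

Throughout, `‖M‖` for a matrix `M` is the spectral norm (operator norm for the Euclidean norm),
i.e. the Schatten infinity norm. -/

section Norms

variable {n : Type*} [Fintype n] [DecidableEq n]

/-- The Schatten 1-norm (trace norm): the sum of the singular values of `ρ`, i.e. of the square
roots of the eigenvalues of `ρᴴ * ρ`. -/
noncomputable def traceNorm (ρ : Matrix n n ℂ) : ℝ :=
  ∑ i, √((Matrix.isHermitian_conjTranspose_mul_self ρ).eigenvalues i)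

/-- The induced Schatten norm from the 1-norm to the infinity norm of a superoperator `Φ`, i.e.
`sup {‖Φ ρ‖ | ‖ρ‖₁ ≤ 1}`. -/
noncomputable def inducedNorm (Φ : Matrix n n ℂ →ₗ[ℂ] Matrix n n ℂ) : ℝ :=
  sSup ((fun ρ => ‖Φ ρ‖) '' {ρ : Matrix n n ℂ | traceNorm ρ ≤ 1})

open scoped ComplexOrder in
theorem norm_entry_le_traceNorm (ρ : Matrix n n ℂ) (i j : n) : ‖ρ i j‖ ≤ traceNorm ρ := by
  have hH := Matrix.isHermitian_conjTranspose_mul_self ρ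
  have hpos : ∀ k, 0 ≤ hH.eigenvalues k :=
    (Matrix.posSemidef_conjTranspose_mul_self ρ).eigenvalues_nonneg
  have h0 : 0 ≤ traceNorm ρ := Finset.sum_nonneg fun k _ => Real.sqrt_nonneg _
  refine abs_le_of_sq_le_sq' ?_ h0 |>.2
  have h1 : ∑ k, hH.eigenvalues k ≤ traceNorm ρ ^ 2 := by
    have h := Finset.sum_sq_le_sq_sum_of_nonneg
      (s := (Finset.univ : Finset n)) (f := fun k => √(hH.eigenvalues k))
      (fun k _ => Real.sqrt_nonneg _)
    simp only [Real.sq_sqrt (hpos _)] at h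
    exact h
  refine le_trans ?_ h1
  have h2 : (∑ k, hH.eigenvalues k : ℝ) = ∑ l, ∑ k, ‖ρ k l‖ ^ 2 := by
    have h := hH.trace_eq_sum_eigenvalues
    have h3 : (ρᴴ * ρ).trace = ((∑ l, ∑ k, ‖ρ k l‖ ^ 2 : ℝ) : ℂ) := by
      simp [Matrix.trace, Matrix.mul_apply, Complex.conj_mul']
    rw [h3] at h
    have h4 : ((∑ l, ∑ k, ‖ρ k l‖ ^ 2 : ℝ) : ℂ) = ((∑ k, hH.eigenvalues k : ℝ) : ℂ) := by
      rw [h, Complex.ofReal_sum]; rfl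
    exact (Complex.ofReal_injective h4).symm
  rw [h2]
  calc ‖ρ i j‖ ^ 2 ≤ ∑ k, ‖ρ k j‖ ^ 2 :=
        Finset.single_le_sum (f := fun k => ‖ρ k j‖ ^ 2) (fun k _ => by positivity)
          (Finset.mem_univ i)
    _ ≤ _ := Finset.single_le_sum (f := fun l => ∑ k, ‖ρ k l‖ ^ 2) (fun k _ => by positivity)
          (Finset.mem_univ j)

/-- The supremum in `inducedNorm` is over a bounded set, so it is a genuine supremum. -/
theorem bddAbove_inducedNorm (Φ : Matrix n n ℂ →ₗ[ℂ] Matrix n n ℂ) :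
    BddAbove ((fun ρ => ‖Φ ρ‖) '' {ρ : Matrix n n ℂ | traceNorm ρ ≤ 1}) := by
  refine ⟨∑ i, ∑ j, ‖Φ (Matrix.single i j 1)‖, ?_⟩
  rintro _ ⟨ρ, hρ, rfl⟩
  have h : Φ ρ = ∑ i, ∑ j, ρ i j • Φ (Matrix.single i j 1) := by
    conv_lhs => rw [Matrix.matrix_eq_sum_single ρ]
    simp only [map_sum]
    refine Finset.sum_congr rfl fun i _ => Finset.sum_congr rfl fun j _ => ?_
    rw [← map_smul, Matrix.smul_single, smul_eq_mul, mul_one]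
  simp only
  rw [h]
  refine (norm_sum_le _ _).trans (Finset.sum_le_sum fun i _ => ?_)
  refine (norm_sum_le _ _).trans (Finset.sum_le_sum fun j _ => ?_)
  rw [norm_smul]
  exact mul_le_of_le_one_left (norm_nonneg _) ((norm_entry_le_traceNorm ρ i j).trans hρ)

/-- The superoperator `ρ ↦ U ρ Uᴴ`. -/
noncomputable def conjChannel (U : Matrix n n ℂ) : Matrix n n ℂ →ₗ[ℂ] Matrix n n ℂ where
  toFun ρ := U * ρ * Uᴴ
  map_add' ρ σ := by rw [mul_add, add_mul]
  map_smul' c ρ := by simp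

end Norms

/-! ### Finite lattices and local Hamiltonians -/

section Lattice

variable {D : ℕ} {Γ : Finset (Fin D → ℤ)}

/-- The graph distance of the lattice `ℤ^D` with nearest-neighbour edges, `∑ i, |x i - y i|`. -/
def siteDist (x y : Γ) : ℕ := ∑ i, (x.1 i - y.1 i).natAbs

/-- `max_{x, y ∈ X} dist(x, y)`, which is `0` for the empty set. -/
def diam (X : Finset Γ) : ℕ := X.sup fun x => X.sup fun y => siteDist x y

/-- `min_{x ∈ X, y ∈ Y} dist(x, y)`, for nonempty `X` and `Y`. -/
noncomputable def regionDist (X Y : Finset Γ) : ℕ :=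
  sInf {k | ∃ x ∈ X, ∃ y ∈ Y, siteDist x y = k}

/-- Operators on the Hilbert space `⨂_{x ∈ Γ} ℂ^q`, as matrices in the product basis, whose
vectors are labelled by the configurations `Γ → Fin q`. -/
abbrev Op (Γ : Finset (Fin D → ℤ)) (q : ℕ) : Type :=
  Matrix (Γ → Fin q) (Γ → Fin q) ℂ

/-- `M` is supported on `X`: it has the form `N ⊗ 1` with `N` an operator on `⨂_{x ∈ X} ℂ^q` and
`1` the identity on the remaining sites. -/
def SupportedOn {q : ℕ} (M : Op Γ q) (X : Finset Γ) : Prop :=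
  ∃ N : Matrix (X → Fin q) (X → Fin q) ℂ, ∀ s s' : Γ → Fin q,
    M s s' = if ∀ x, x ∉ X → s x = s' x then N (fun x => s x) (fun x => s' x) else 0

/-- A geometrically local Hamiltonian `H = ∑_{X ⊆ Γ} H_X` on a finite lattice `Γ ⊆ ℤ^D`. -/
structure LocalHamiltonian (Γ : Finset (Fin D → ℤ)) (q : ℕ) where
  /-- The interaction terms `H_X`. -/
  term : Finset Γ → Op Γ q
  isHermitian : ∀ X, (term X).IsHermitian
  supportedOn : ∀ X, SupportedOn (term X) X
  eq_zero_of_one_lt_diam : ∀ X, 1 < diam X → term X = 0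
  norm_le_one : ∀ X, ‖term X‖ ≤ 1

namespace LocalHamiltonian

variable {q : ℕ} (H : LocalHamiltonian Γ q)

/-- `H_S = ∑_{X ⊆ S} H_X`, the sum of the terms supported on the region `S`. -/
noncomputable def onRegion (S : Finset Γ) : Op Γ q := ∑ X ∈ S.powerset, H.term X

/-- The time evolution unitary `U_S = exp(-i t H_S)`. -/
noncomputable def evol (t : ℝ) (S : Finset Γ) : Op Γ q :=
  NormedSpace.exp ((-Complex.I * (t : ℂ)) • H.onRegion S)

/-- The evolutionary channel `ρ ↦ U_S ρ U_Sᴴ`. -/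
noncomputable def channel (t : ℝ) (S : Finset Γ) : Op Γ q →ₗ[ℂ] Op Γ q :=
  conjChannel (H.evol t S)

/-- The adjoint (equivalently, inverse) channel `ρ ↦ U_Sᴴ ρ U_S`. -/
noncomputable def channelAdj (t : ℝ) (S : Finset Γ) : Op Γ q →ₗ[ℂ] Op Γ q :=
  conjChannel (H.evol t S)ᴴ

/-- `∑_{X : bd(AB, C)} ‖H_X‖`, over all `X ⊆ A ∪ B ∪ C` with `X ⊄ A ∪ B` and `X ⊄ C`. -/
noncomputable def boundaryWeight (A B C : Finset Γ) : ℝ :=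
  ∑ X ∈ (A ∪ B ∪ C).powerset with ¬ X ⊆ A ∪ B ∧ ¬ X ⊆ C, ‖H.term X‖

end LocalHamiltonian

end Lattice

end LocalDecomp

/-! ### Unitary evolutions in a C⋆-algebra -/

/-! For S = AB and S = B, drop the terms crossing the cut between S and C. The remaining evolution
factorises into `U_S` and a factor on C that is the same for both S, so `U_{AB} U_B†` equals the
ratio of the two cut evolutions (`evol_mul_star_evol_mul_evol_sub`). The error is therefore, up to a
unitary, the difference of two interaction pictures, generated by the cut terms in the Heisenberg
pictures of the two cut Hamiltonians. By Duhamel's principle (`norm_interaction_sub_le`) it is at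
most the time integral of the difference of these generators.

The cut Hamiltonians differ only in terms touching A, whereas nonzero cut terms lie near C. A
Lieb–Robinson bound (`norm_heisenberg_sub_le`) makes the difference at most of order `(2gt)^k / k!`
with k = dist(A,C) - 2, and the factorial beats any exponential. Spectral norm ≤ trace norm carries
the estimate from unitaries to channels. -/

namespace LocalDecomp

section Evolution

variable {A : Type*} [CStarAlgebra A]

/-- The propagator `exp(-i t H)`. -/
noncomputable def propagator (H : A) (t : ℝ) : A :=
  NormedSpace.exp ((-Complex.I * (t : ℂ)) • H)

/-- The Heisenberg evolution `exp(i t H) O exp(-i t H)`. -/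
noncomputable def heisenberg (H : A) (t : ℝ) (O : A) : A :=
  star (propagator H t) * O * propagator H t

theorem propagator_zero (H : A) : propagator H 0 = 1 := by simp [propagator]

theorem propagator_neg (H : A) (t : ℝ) : propagator (-H) (-t) = propagator H t := by
  simp [propagator]

theorem hasDerivAt_propagator (H : A) (t : ℝ) :
    HasDerivAt (propagator H) (-(Complex.I • (H * propagator H t))) t := by
  have h (s : ℝ) : propagator H s = NormedSpace.exp (s • (-Complex.I • H)) := by
    rw [propagator, ← Complex.coe_smul, smul_smul, mul_comm]
  have h1 := hasDerivAt_exp_smul_const' (𝕂 := ℝ) (-Complex.I • H) t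
  rw [← h] at h1
  rw [funext h]
  simpa [h] using h1

theorem propagator_mem_unitary {H : A} (hH : IsSelfAdjoint H) (t : ℝ) :
    propagator H t ∈ unitary A := by
  let _ : NormedAlgebra ℚ A := NormedAlgebra.restrictScalars ℚ ℂ A
  refine NormedSpace.exp_mem_unitary_of_mem_skewAdjoint ?_
  rw [skewAdjoint.mem_iff, star_smul, hH.star_eq]
  simp

theorem propagator_add {H K : A} (h : Commute H K) (t : ℝ) :
    propagator (H + K) t = propagator H t * propagator K t := by
  let _ : NormedAlgebra ℚ A := NormedAlgebra.restrictScalars ℚ ℂ A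
  rw [propagator, smul_add,
    NormedSpace.exp_add_of_commute ((h.smul_left _).smul_right _)]
  rfl

theorem commute_propagator {H O : A} (h : Commute O H) (t : ℝ) :
    Commute O (propagator H t) :=
  (h.smul_right _).exp_right

theorem norm_heisenberg {H : A} (hH : IsSelfAdjoint H) (t : ℝ) (O : A) :
    ‖heisenberg H t O‖ = ‖O‖ := by
  have h := propagator_mem_unitary hH t
  rw [heisenberg, CStarRing.norm_mul_mem_unitary _ h,
    CStarRing.norm_mem_unitary_mul _ (Unitary.star_mem h)]

theorem heisenberg_sum {ι : Type*} (H : A) (t : ℝ) (s : Finset ι) (f : ι → A) :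
    heisenberg H t (∑ i ∈ s, f i) = ∑ i ∈ s, heisenberg H t (f i) := by
  simp only [heisenberg, Finset.mul_sum, Finset.sum_mul]

theorem heisenberg_neg (H : A) (t : ℝ) (O : A) :
    heisenberg H t (-O) = -heisenberg H t O := by
  simp [heisenberg]

/-- The evolution under `H + K` in the interaction picture of `H`. -/
noncomputable def interaction (H K : A) (t : ℝ) : A :=
  star (propagator H t) * propagator (H + K) t

theorem interaction_mem_unitary {H K : A} (hH : IsSelfAdjoint H) (hK : IsSelfAdjoint K) (t : ℝ) :
    interaction H K t ∈ unitary A :=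
  mul_mem (Unitary.star_mem (propagator_mem_unitary hH t))
    (propagator_mem_unitary (hH.add hK) t)

/-- In the product rule the two contributions of H cancel, so only K drives the interaction picture.
-/
theorem hasDerivAt_interaction {H : A} (hH : IsSelfAdjoint H) (K : A) (t : ℝ) :
    HasDerivAt (interaction H K)
      (-(Complex.I • (heisenberg H t K * interaction H K t))) t := by
  have h := (hasDerivAt_propagator H t).star.mul (hasDerivAt_propagator (H + K) t)
  refine h.congr_deriv ?_
  have hu : propagator H t * star (propagator H t) = 1 :=
    Unitary.mul_star_self_of_mem (propagator_mem_unitary hH t)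
  have e : heisenberg H t K * interaction H K t
      = star (propagator H t) * K * propagator (H + K) t := by
    rw [heisenberg, interaction, mul_assoc, ← mul_assoc (propagator H t), hu, one_mul]
  rw [e]
  simp only [star_neg, star_smul, star_mul, hH.star_eq, smul_mul_assoc, mul_smul_comm, neg_mul,
    mul_neg, add_mul, mul_add, smul_add, mul_assoc]
  simp

/-- Two interaction-picture evolutions are close if their generators are. -/
theorem norm_interaction_sub_le {H₁ H₂ K₁ K₂ : A} (hH₁ : IsSelfAdjoint H₁)
    (hH₂ : IsSelfAdjoint H₂) (hK₁ : IsSelfAdjoint K₁) (hK₂ : IsSelfAdjoint K₂)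
    {B B' : ℝ → ℝ} {T : ℝ} (hT : 0 ≤ T) (hB0 : 0 ≤ B 0) (hB : ∀ s, HasDerivAt B (B' s) s)
    (h : ∀ s ∈ Set.Ico 0 T, ‖heisenberg H₁ s K₁ - heisenberg H₂ s K₂‖ ≤ B' s) :
    ‖interaction H₁ K₁ T - interaction H₂ K₂ T‖ ≤ B T := by
  -- The relative evolution W₂†W₁ starts at 1, and its derivative is the difference of the
  -- generators between two unitaries. The majorant `B` takes the place of an integral.
  have hd (s : ℝ) : HasDerivAt (fun s => star (interaction H₂ K₂ s) * interaction H₁ K₁ s - 1)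
      (-(Complex.I • (star (interaction H₂ K₂ s) *
        ((heisenberg H₁ s K₁ - heisenberg H₂ s K₂) * interaction H₁ K₁ s)))) s := by
    refine (((hasDerivAt_interaction hH₂ K₂ s).star.mul
      (hasDerivAt_interaction hH₁ K₁ s)).sub_const 1).congr_deriv ?_
    have hs : star (heisenberg H₂ s K₂) = heisenberg H₂ s K₂ := by
      simp [heisenberg, hK₂.star_eq, mul_assoc]
    simp only [star_neg, star_smul, star_mul, hs, smul_mul_assoc, mul_smul_comm, neg_mul,
      mul_neg, sub_mul, mul_sub, smul_sub, mul_assoc]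
    simp
    abel
  have hu₁ (s : ℝ) := interaction_mem_unitary hH₁ hK₁ s
  have hu₂ (s : ℝ) := interaction_mem_unitary hH₂ hK₂ s
  have key := image_norm_le_of_norm_deriv_right_le_deriv_boundary (a := 0) (b := T)
    (fun s _ => (hd s).continuousAt.continuousWithinAt) (fun s _ => (hd s).hasDerivWithinAt)
    (B := B) (B' := B') (by simpa [interaction, propagator_zero] using hB0) hB
    (fun s hs => by
      rw [norm_neg, norm_smul, Complex.norm_I, one_mul,
        CStarRing.norm_mem_unitary_mul _ (Unitary.star_mem (hu₂ s)),
        CStarRing.norm_mul_mem_unitary _ (hu₁ s)]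
      exact h s hs) (Set.right_mem_Icc.2 hT)
  have e : interaction H₁ K₁ T - interaction H₂ K₂ T
      = interaction H₂ K₂ T * (star (interaction H₂ K₂ T) * interaction H₁ K₁ T - 1) := by
    rw [mul_sub, ← mul_assoc, Unitary.mul_star_self_of_mem (hu₂ T), one_mul, mul_one]
  rw [e, CStarRing.norm_mem_unitary_mul _ (hu₂ T)]
  exact key

theorem norm_conj_sub_conj_le {U V : A} (hU : U ∈ unitary A) (hV : V ∈ unitary A) (O : A) :
    ‖U * O * star U - V * O * star V‖ ≤ 2 * ‖U - V‖ * ‖O‖ := by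
  have e : U * O * star U - V * O * star V
      = (U - V) * O * star U + V * (O * star (U - V)) := by
    rw [star_sub]; noncomm_ring
  rw [e]
  refine (norm_add_le _ _).trans ?_
  rw [CStarRing.norm_mul_mem_unitary _ (Unitary.star_mem hU), CStarRing.norm_mem_unitary_mul _ hV]
  have h1 := norm_mul_le (U - V) O
  have h2 := norm_mul_le O (star (U - V))
  rw [norm_star] at h2
  linarith

/-- An observable evolves only through the part of the Hamiltonian it does not commute with. -/
theorem heisenberg_add_eq {H G O : A} (hH : IsSelfAdjoint H)
    (h : Commute O H) (t : ℝ) :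
    heisenberg (H + G) t O
      = interaction (H + G) (-G) t * O * star (interaction (H + G) (-G) t) := by
  have hu : propagator H t * star (propagator H t) = 1 :=
    Unitary.mul_star_self_of_mem (propagator_mem_unitary hH t)
  -- Evolution under H alone fixes O, so it can be inserted for free; what remains is the
  -- interaction picture with H + G as the reference.
  have hc : propagator H t * O * star (propagator H t) = O := by
    rw [← (commute_propagator h t).eq, mul_assoc, hu, mul_one]
  rw [interaction, add_neg_cancel_right, star_mul, star_star, heisenberg]
  conv_lhs => rw [← hc]
  simp only [mul_assoc]

end Evolution

/-! ### Lieb–Robinson bound -/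

section LiebRobinson

variable {A : Type*} [CStarAlgebra A] {ι : Type*}

/-- A Lieb–Robinson bound: two Hamiltonians built from the same local terms which agree within
`k` steps of the term `h Y` evolve it in nearly the same way. -/
theorem norm_heisenberg_sub_le (h : ι → A) (hsa : ∀ Y, IsSelfAdjoint (h Y))
    (overlap : ι → ι → Prop) (hcomm : ∀ Y Z, ¬ overlap Y Z → Commute (h Y) (h Z))
    (F₁ F₂ : Finset ι) (P : ℕ → ι → Prop)
    (hP : ∀ k Y Z, P (k + 1) Y → overlap Y Z → h Y ≠ 0 → h Z ≠ 0 →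
      P k Z ∧ (Z ∈ F₁ ↔ Z ∈ F₂))
    {g : ℝ} (hg : ∀ Y, h Y ≠ 0 → ∀ F : Finset ι, (∀ Z ∈ F, overlap Y Z ∧ h Z ≠ 0) →
      ∑ Z ∈ F, ‖h Z‖ ≤ g)
    (k : ℕ) (Y : ι) (hY : P k Y) {t : ℝ} (ht : 0 ≤ t) :
    ‖heisenberg (∑ Z ∈ F₁, h Z) t (h Y) - heisenberg (∑ Z ∈ F₂, h Z) t (h Y)‖
      ≤ 2 * ‖h Y‖ * ((2 * g * t) ^ k / k.factorial) := by
  classical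
  have hsum (F : Finset ι) : IsSelfAdjoint (∑ Z ∈ F, h Z) := isSelfAdjoint_sum _ fun Z _ => hsa Z
  -- `P k Y` is to be read as: Y is at least k steps from where `F₁` and `F₂` differ.
  induction k generalizing Y t with
  | zero =>
    refine (norm_sub_le _ _).trans ?_
    rw [norm_heisenberg (hsum _), norm_heisenberg (hsum _)]
    simp [two_mul]
  | succ k ih =>
    rcases eq_or_ne (h Y) 0 with h0 | h0
    · simp [h0, heisenberg]
    have hg0 : 0 ≤ g := by simpa using hg Y h0 ∅
    -- Only neighbours of Y move `h Y` at first order, and at level k + 1 both families have the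
    -- same neighbours. Both evolutions thus have the same driving term, seen in different
    -- Heisenberg pictures.
    set N := F₁.filter fun Z => overlap Y Z ∧ h Z ≠ 0 with hN
    have hN₂ : N = F₂.filter fun Z => overlap Y Z ∧ h Z ≠ 0 := by
      ext Z
      simp only [hN, Finset.mem_filter]
      exact and_congr_left fun hZ => (hP k Y Z hY hZ.1 h0 hZ.2).2
    have hfar (F : Finset ι) :
        Commute (h Y) (∑ Z ∈ F.filter fun Z => ¬ (overlap Y Z ∧ h Z ≠ 0), h Z) := by
      refine Commute.sum_right _ _ _ fun Z hZ => ?_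
      rcases not_and_or.1 (Finset.mem_filter.1 hZ).2 with hn | hn
      · exact hcomm Y Z hn
      · rw [not_not.1 hn]; exact Commute.zero_right _
    have e₁ : ∑ Z ∈ F₁, h Z
        = ∑ Z ∈ F₁.filter (fun Z => ¬ (overlap Y Z ∧ h Z ≠ 0)), h Z + ∑ Z ∈ N, h Z := by
      rw [hN, add_comm, Finset.sum_filter_add_sum_filter_not]
    have e₂ : ∑ Z ∈ F₂, h Z
        = ∑ Z ∈ F₂.filter (fun Z => ¬ (overlap Y Z ∧ h Z ≠ 0)), h Z + ∑ Z ∈ N, h Z := by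
      rw [hN₂, add_comm, Finset.sum_filter_add_sum_filter_not]
    have r₁ := heisenberg_add_eq (G := ∑ Z ∈ N, h Z) (hsum _) (hfar F₁) t
    have r₂ := heisenberg_add_eq (G := ∑ Z ∈ N, h Z) (hsum _) (hfar F₂) t
    rw [← e₁] at r₁
    rw [← e₂] at r₂
    rw [r₁, r₂]
    refine (norm_conj_sub_conj_le (interaction_mem_unitary (hsum _) (hsum _).neg t)
      (interaction_mem_unitary (hsum _) (hsum _).neg t) (h Y)).trans ?_
    suffices hW : ‖interaction (∑ Z ∈ F₁, h Z) (-∑ Z ∈ N, h Z) t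
        - interaction (∑ Z ∈ F₂, h Z) (-∑ Z ∈ N, h Z) t‖
        ≤ (2 * g * t) ^ (k + 1) / (k + 1).factorial by
      calc _ ≤ 2 * ((2 * g * t) ^ (k + 1) / (k + 1).factorial) * ‖h Y‖ := by gcongr
        _ = _ := by ring
    -- Integrating the level-k bound over time supplies one more power of t and the next factor of
    -- the factorial.
    refine norm_interaction_sub_le (B := fun s => (2 * g * s) ^ (k + 1) / (k + 1).factorial)
      (B' := fun s => 2 * g * ((2 * g * s) ^ k / k.factorial))
      (hsum _) (hsum _) (hsum _).neg (hsum _).neg ht (by simp) (fun s => ?_) fun s hs => ?_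
    · refine ((((hasDerivAt_id s).const_mul (2 * g)).pow (k + 1)).div_const _).congr_deriv ?_
      rw [Nat.factorial_succ]
      push_cast
      have := Nat.cast_add_one_ne_zero (R := ℝ) k
      simp
      field_simp
    · rw [heisenberg_neg, heisenberg_neg, neg_sub_neg, norm_sub_rev, heisenberg_sum,
        heisenberg_sum, ← Finset.sum_sub_distrib]
      have hs0 : 0 ≤ s := hs.1
      calc _ ≤ ∑ Z ∈ N, 2 * ‖h Z‖ * ((2 * g * s) ^ k / k.factorial) :=
            norm_sum_le_of_le _ fun Z hZ =>
              have hZ' := (Finset.mem_filter.1 hZ).2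
              ih Z (hP k Y Z hY hZ'.1 h0 hZ'.2).1 hs0
        _ = 2 * (∑ Z ∈ N, ‖h Z‖) * ((2 * g * s) ^ k / k.factorial) := by
            rw [Finset.mul_sum, Finset.sum_mul]
        _ ≤ _ := by
            gcongr
            exact hg Y h0 N fun Z hZ => (Finset.mem_filter.1 hZ).2

end LiebRobinson

end LocalDecomp

namespace LocalDecomp

/-! ### From unitaries to channels -/

section TraceNorm

variable {n : Type*} [Fintype n] [DecidableEq n]

theorem traceNorm_nonneg (ρ : Matrix n n ℂ) : 0 ≤ traceNorm ρ :=
  Finset.sum_nonneg fun _ _ => Real.sqrt_nonneg _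

open scoped ComplexOrder in
-- By the C⋆-identity, ‖ρ‖² is the norm of ρ†ρ; after diagonalisation this is the largest squared
-- singular value, and each singular value is at most their sum.
theorem norm_le_traceNorm (ρ : Matrix n n ℂ) : ‖ρ‖ ≤ traceNorm ρ := by
  have hH := Matrix.isHermitian_conjTranspose_mul_self ρ
  have hpos : ∀ k, 0 ≤ hH.eigenvalues k :=
    (Matrix.posSemidef_conjTranspose_mul_self ρ).eigenvalues_nonneg
  have h0 := traceNorm_nonneg ρ
  refine abs_le_of_sq_le_sq' ?_ h0 |>.2
  rw [sq, ← Matrix.l2_opNorm_conjTranspose_mul_self]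
  have hs := hH.spectral_theorem
  rw [Unitary.conjStarAlgAut_apply] at hs
  rw [hs, CStarRing.norm_mul_mem_unitary _ (Unitary.star_mem hH.eigenvectorUnitary.2),
    CStarRing.norm_coe_unitary_mul, Matrix.l2_opNorm_diagonal,
    pi_norm_le_iff_of_nonneg (sq_nonneg _)]
  intro i
  have hi : √(hH.eigenvalues i) ≤ traceNorm ρ :=
    Finset.single_le_sum (f := fun k => √(hH.eigenvalues k)) (fun k _ => Real.sqrt_nonneg _)
      (Finset.mem_univ i)
  calc ‖(RCLike.ofReal ∘ hH.eigenvalues : n → ℂ) i‖ = hH.eigenvalues i := by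
        simp [abs_of_nonneg (hpos i)]
    _ = √(hH.eigenvalues i) ^ 2 := (Real.sq_sqrt (hpos i)).symm
    _ ≤ _ := by gcongr

theorem conjChannel_comp (U V : Matrix n n ℂ) :
    conjChannel U ∘ₗ conjChannel V = conjChannel (U * V) := by
  ext1 ρ
  simp [conjChannel, mul_assoc]

theorem inducedNorm_conjChannel_sub_le {U V : Matrix n n ℂ}
    (hU : U ∈ unitary (Matrix n n ℂ)) (hV : V ∈ unitary (Matrix n n ℂ)) :
    inducedNorm (conjChannel U - conjChannel V) ≤ 2 * ‖U - V‖ := by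
  refine Real.sSup_le ?_ (by positivity)
  rintro _ ⟨ρ, hρ, rfl⟩
  have h : ‖ρ‖ ≤ 1 := (norm_le_traceNorm ρ).trans hρ
  exact (norm_conj_sub_conj_le hU hV ρ).trans (mul_le_of_le_one_right (by positivity) h)

end TraceNorm

/-! ### Lattice geometry and commuting supports -/

section Locality

variable {D : ℕ} {Γ : Finset (Fin D → ℤ)} {q : ℕ}

theorem siteDist_comm (x y : Γ) : siteDist x y = siteDist y x :=
  Finset.sum_congr rfl fun _ _ => by omega

theorem siteDist_triangle (x y z : Γ) : siteDist x z ≤ siteDist x y + siteDist y z := by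
  rw [siteDist, siteDist, siteDist, ← Finset.sum_add_distrib]
  exact Finset.sum_le_sum fun _ _ => by omega

theorem natAbs_sub_le_siteDist (x y : Γ) (i : Fin D) :
    (x.1 i - y.1 i).natAbs ≤ siteDist x y :=
  Finset.single_le_sum (f := fun i => (x.1 i - y.1 i).natAbs) (fun _ _ => Nat.zero_le _)
    (Finset.mem_univ i)

theorem siteDist_self (x : Γ) : siteDist x x = 0 := by simp [siteDist]

theorem siteDist_le_diam {X : Finset Γ} {x y : Γ} (hx : x ∈ X) (hy : y ∈ X) :
    siteDist x y ≤ diam X :=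
  (Finset.le_sup (f := fun y => siteDist x y) hy).trans
    (Finset.le_sup (f := fun x => X.sup fun y => siteDist x y) hx)

theorem regionDist_le {X Y : Finset Γ} {x y : Γ} (hx : x ∈ X) (hy : y ∈ Y) :
    regionDist X Y ≤ siteDist x y :=
  Nat.sInf_le ⟨x, hx, y, hy, rfl⟩

theorem card_filter_siteDist_le (y : Γ) (r : ℕ) :
    (Finset.univ.filter fun x : Γ => siteDist x y ≤ r).card ≤ (2 * r + 1) ^ D := by
  have h : ((Fintype.piFinset fun i => Finset.Icc (y.1 i - r) (y.1 i + r)) :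
      Finset (Fin D → ℤ)).card = (2 * r + 1) ^ D := by
    simp only [Fintype.card_piFinset, Int.card_Icc]
    rw [Finset.prod_congr rfl (g := fun _ => 2 * r + 1) fun i _ => by omega]
    simp
  rw [← h]
  refine Finset.card_le_card_of_injOn (fun x => x.1) (fun x hx => ?_)
    Subtype.val_injective.injOn
  have hx' : siteDist x y ≤ r := by simpa using hx
  simp only [Finset.mem_coe, Fintype.mem_piFinset, Finset.mem_Icc]
  intro i
  have := natAbs_sub_le_siteDist x y i
  omega

theorem SupportedOn.neg {M : Op Γ q} {X : Finset Γ} (h : SupportedOn M X) :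
    SupportedOn (-M) X := by
  obtain ⟨N, hN⟩ := h
  refine ⟨-N, fun s s' => ?_⟩
  rw [Matrix.neg_apply, hN]
  split_ifs <;> simp

/-- Only one intermediate configuration contributes: s' on X and s elsewhere. The resulting formula
is symmetric in the two factors, which gives commutation. -/
theorem mul_apply_of_supportedOn_disjoint {M N : Op Γ q} {X Y : Finset Γ}
    {M' : Matrix (X → Fin q) (X → Fin q) ℂ} {N' : Matrix (Y → Fin q) (Y → Fin q) ℂ}
    (hM : ∀ s s' : Γ → Fin q,
      M s s' = if ∀ x, x ∉ X → s x = s' x then M' (fun x => s x) (fun x => s' x) else 0)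
    (hN : ∀ s s' : Γ → Fin q,
      N s s' = if ∀ x, x ∉ Y → s x = s' x then N' (fun x => s x) (fun x => s' x) else 0)
    (h : Disjoint X Y) (s s' : Γ → Fin q) :
    (M * N) s s' = if ∀ x, x ∉ X → x ∉ Y → s x = s' x then
      M' (fun x => s x) (fun x => s' x) * N' (fun x => s x) (fun x => s' x) else 0 := by
  rw [Matrix.mul_apply, Finset.sum_eq_single (X.piecewise s' s)]
  · have h1 : ∀ x, x ∉ X → s x = X.piecewise s' s x := fun x hx => by simp [hx]
    have h2 : (fun x : X => X.piecewise s' s x) = fun x : X => s' x := by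
      ext x; simp
    have h3 : (fun y : Y => X.piecewise s' s y) = fun y : Y => s y := by
      ext y
      simp [Finset.disjoint_right.1 h y.2]
    have h4 : (∀ x, x ∉ Y → X.piecewise s' s x = s' x) ↔ ∀ x, x ∉ X → x ∉ Y → s x = s' x := by
      refine forall_congr' fun x => ?_
      by_cases hx : x ∈ X <;> simp [hx]
    rw [hM, hN, if_pos h1, h2, h3]
    simp only [h4, mul_ite, mul_zero]
  · intro u _ hu
    rw [hM, hN]
    by_cases h1 : ∀ x, x ∉ X → s x = u x
    · rw [if_neg (c := ∀ x, x ∉ Y → u x = s' x), mul_zero]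
      intro h2
      refine hu (funext fun x => ?_)
      by_cases hx : x ∈ X
      · simp [hx, h2 x (Finset.disjoint_left.1 h hx)]
      · simp [hx, h1 x hx]
    · rw [if_neg h1, zero_mul]
  · simp

theorem SupportedOn.commute {M N : Op Γ q} {X Y : Finset Γ} (hM : SupportedOn M X)
    (hN : SupportedOn N Y) (h : Disjoint X Y) : Commute M N := by
  obtain ⟨M', hM⟩ := hM
  obtain ⟨N', hN⟩ := hN
  ext s s'
  rw [mul_apply_of_supportedOn_disjoint hM hN h, mul_apply_of_supportedOn_disjoint hN hM h.symm]
  refine if_congr ?_ (mul_comm _ _) rfl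
  exact forall_congr' fun x => ⟨fun h a b => h b a, fun h a b => h b a⟩

end Locality

/-! ### Cutting the Hamiltonian and estimating the error -/

namespace LocalHamiltonian

variable {D : ℕ} {Γ : Finset (Fin D → ℤ)} {q : ℕ} (H : LocalHamiltonian Γ q)

/-- The Hamiltonian with the opposite sign, which runs the evolution backwards. -/
def reverse : LocalHamiltonian Γ q where
  term X := -H.term X
  isHermitian X := (H.isHermitian X).neg
  supportedOn X := (H.supportedOn X).neg
  eq_zero_of_one_lt_diam X hX := by rw [H.eq_zero_of_one_lt_diam X hX, neg_zero]
  norm_le_one X := by rw [norm_neg]; exact H.norm_le_one X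

theorem evol_eq_propagator (t : ℝ) (S : Finset Γ) :
    H.evol t S = propagator (H.onRegion S) t := rfl

theorem reverse_evol (t : ℝ) (S : Finset Γ) : H.reverse.evol (-t) S = H.evol t S := by
  rw [evol_eq_propagator, evol_eq_propagator, ← propagator_neg (H.onRegion S)]
  simp [onRegion, reverse]

theorem reverse_boundaryWeight (A B C : Finset Γ) :
    H.reverse.boundaryWeight A B C = H.boundaryWeight A B C := by
  simp [boundaryWeight, reverse]

theorem boundaryWeight_nonneg (A B C : Finset Γ) : 0 ≤ H.boundaryWeight A B C :=
  Finset.sum_nonneg fun _ _ => norm_nonneg _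

theorem isSelfAdjoint_sum_term (F : Finset (Finset Γ)) : IsSelfAdjoint (∑ X ∈ F, H.term X) :=
  isSelfAdjoint_sum _ fun X _ => H.isHermitian X

theorem evol_mem_unitary (t : ℝ) (S : Finset Γ) : H.evol t S ∈ unitary (Op Γ q) :=
  propagator_mem_unitary (H.isSelfAdjoint_sum_term _) t

theorem siteDist_le_one {X : Finset Γ} (hX : H.term X ≠ 0) {x y : Γ} (hx : x ∈ X)
    (hy : y ∈ X) : siteDist x y ≤ 1 := by
  refine (siteDist_le_diam hx hy).trans ?_
  by_contra h
  exact hX (H.eq_zero_of_one_lt_diam X (not_le.1 h))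

theorem sum_norm_overlapping_le {Y : Finset Γ} (hY : H.term Y ≠ 0) (F : Finset (Finset Γ))
    (hF : ∀ Z ∈ F, ¬ Disjoint Y Z ∧ H.term Z ≠ 0) :
    ∑ Z ∈ F, ‖H.term Z‖ ≤ 2 ^ 5 ^ D := by
  rcases Y.eq_empty_or_nonempty with rfl | ⟨y, hy⟩
  · have : F = ∅ := Finset.eq_empty_of_forall_notMem fun Z hZ => (hF Z hZ).1 (by simp)
    simp [this]
  -- Y and Z share a site and have diameter at most 1, so Z lies in the ball of radius 2 about y.
  -- That ball has at most 5^D sites.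
  have hsub : F ⊆ (Finset.univ.filter fun x : Γ => siteDist x y ≤ 2).powerset := by
    intro Z hZ
    obtain ⟨hd, h0⟩ := hF Z hZ
    obtain ⟨w, hwY, hwZ⟩ := Finset.not_disjoint_iff.1 hd
    rw [Finset.mem_powerset]
    intro z hz
    have h1 := H.siteDist_le_one h0 hz hwZ
    have h2 := H.siteDist_le_one hY hwY hy
    have h3 := siteDist_triangle z w y
    simp only [Finset.mem_filter, Finset.mem_univ, true_and]
    omega
  calc ∑ Z ∈ F, ‖H.term Z‖ ≤ ∑ Z ∈ F, (1 : ℝ) := Finset.sum_le_sum fun Z _ => H.norm_le_one Z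
    _ = (F.card : ℝ) := by simp
    _ ≤ ((2 ^ 5 ^ D : ℕ) : ℝ) := by
        have h1 := Finset.card_le_card hsub
        rw [Finset.card_powerset] at h1
        exact_mod_cast h1.trans (Nat.pow_le_pow_right (by norm_num)
          (card_filter_siteDist_le y 2))
    _ = _ := by push_cast; rfl

/-- The sets contained in one of the two regions `S` and `C`. -/
def within (S C : Finset Γ) : Finset (Finset Γ) :=
  Finset.univ.filter fun X => X ⊆ S ∨ X ⊆ C

/-- The subsets of `S ∪ C` contained in neither of the two regions `S` and `C`. -/
def across (S C : Finset Γ) : Finset (Finset Γ) :=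
  (S ∪ C).powerset.filter fun X => ¬ X ⊆ S ∧ ¬ X ⊆ C

theorem onRegion_union (S C : Finset Γ) :
    H.onRegion (S ∪ C) = ∑ X ∈ within S C, H.term X + ∑ X ∈ across S C, H.term X := by
  have e : within S C = (S ∪ C).powerset.filter fun X => ¬ (¬ X ⊆ S ∧ ¬ X ⊆ C) := by
    ext X
    simp only [within, Finset.mem_filter, Finset.mem_univ, true_and, Finset.mem_powerset,
      not_and_or, not_not]
    refine ⟨fun h => ⟨?_, h⟩, fun h => h.2⟩
    exact h.elim (fun h => h.trans Finset.subset_union_left)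
      (fun h => h.trans Finset.subset_union_right)
  rw [e, across, add_comm, Finset.sum_filter_add_sum_filter_not, onRegion]

theorem propagator_within {S C : Finset Γ} (h : Disjoint S C) (t : ℝ) :
    propagator (∑ X ∈ within S C, H.term X) t
      = H.evol t S * propagator (∑ X ∈ C.powerset.erase ∅, H.term X) t := by
  -- The empty set lies in both regions; erasing it on the C side prevents counting its term twice.
  have e : within S C = S.powerset ∪ C.powerset.erase ∅ := by
    ext X
    simp only [within, Finset.mem_filter, Finset.mem_univ, true_and, Finset.mem_union,
      Finset.mem_powerset, Finset.mem_erase]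
    rcases eq_or_ne X ∅ with rfl | hX
    · simp
    · simp [hX]
  have hd : Disjoint S.powerset (C.powerset.erase ∅) := by
    rw [Finset.disjoint_left]
    intro X hX hX'
    rw [Finset.mem_erase, Finset.mem_powerset] at hX'
    exact hX'.1 (Finset.subset_empty.1 (h (Finset.mem_powerset.1 hX) hX'.2))
  rw [e, Finset.sum_union hd, propagator_add]
  · rfl
  · refine Commute.sum_left _ _ _ fun X hX => Commute.sum_right _ _ _ fun Y hY => ?_
    exact (H.supportedOn X).commute (H.supportedOn Y)
      (h.mono (Finset.mem_powerset.1 hX) (Finset.mem_powerset.1 (Finset.mem_erase.1 hY).2))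

theorem evol_mul_star_evol_mul_evol_sub {A B C : Finset Γ} (hAC : Disjoint A C)
    (hBC : Disjoint B C) (t : ℝ) :
    H.evol t (A ∪ B) * (star (H.evol t B) * H.evol t (B ∪ C)) - H.evol t (A ∪ B ∪ C)
      = propagator (∑ X ∈ within (A ∪ B) C, H.term X) t *
        (interaction (∑ X ∈ within B C, H.term X) (∑ X ∈ across B C, H.term X) t
          - interaction (∑ X ∈ within (A ∪ B) C, H.term X)
              (∑ X ∈ across (A ∪ B) C, H.term X) t) := by
  have u₁ : propagator (∑ X ∈ within (A ∪ B) C, H.term X) t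
      * star (propagator (∑ X ∈ within (A ∪ B) C, H.term X) t) = 1 :=
    Unitary.mul_star_self_of_mem (propagator_mem_unitary (H.isSelfAdjoint_sum_term _) t)
  have u₂ : propagator (∑ X ∈ within (A ∪ B) C, H.term X) t
      * star (propagator (∑ X ∈ within B C, H.term X) t) = H.evol t (A ∪ B) * star (H.evol t B) := by
    have uR : propagator (∑ X ∈ C.powerset.erase ∅, H.term X) t
        * star (propagator (∑ X ∈ C.powerset.erase ∅, H.term X) t) = 1 :=
      Unitary.mul_star_self_of_mem (propagator_mem_unitary (H.isSelfAdjoint_sum_term _) t)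
    rw [H.propagator_within (Finset.disjoint_union_left.2 ⟨hAC, hBC⟩), H.propagator_within hBC,
      star_mul, mul_assoc, ← mul_assoc (propagator _ t) (star _), uR, one_mul]
  rw [interaction, interaction, ← onRegion_union, ← onRegion_union, mul_sub, ← mul_assoc,
    ← mul_assoc, ← mul_assoc, u₁, u₂, one_mul]
  rfl

theorem heisenberg_across_sub_le {A B C : Finset Γ} (hAC : Disjoint A C) {t : ℝ} (ht : 0 ≤ t) :
    ‖heisenberg (∑ X ∈ within B C, H.term X) t (∑ X ∈ across B C, H.term X)
        - heisenberg (∑ X ∈ within (A ∪ B) C, H.term X) t (∑ X ∈ across (A ∪ B) C, H.term X)‖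
      ≤ 2 * H.boundaryWeight A B C * ((2 * 2 ^ 5 ^ D * t) ^ (regionDist A C - 2)
          / (regionDist A C - 2).factorial) := by
  have hw : H.boundaryWeight A B C = ∑ X ∈ across (A ∪ B) C, ‖H.term X‖ := rfl
  have hsub : across B C ⊆ across (A ∪ B) C := by
    intro X hX
    simp only [across, Finset.mem_filter, Finset.mem_powerset] at hX ⊢
    refine ⟨hX.1.trans (Finset.union_subset_union_left Finset.subset_union_right), fun h => ?_,
      hX.2.2⟩
    refine hX.2.1 fun x hx => ?_
    have h1 := hX.1 hx
    have h2 := h hx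
    rw [Finset.mem_union] at h1 h2
    rcases h1 with h1 | h1
    · exact h1
    · exact h2.resolve_left (Finset.disjoint_right.1 hAC h1)
  -- For distance below 2 the truncated exponent is 0, and the triangle inequality already suffices.
  rcases lt_or_ge (regionDist A C) 2 with hd | hd
  · have hk : regionDist A C - 2 = 0 := by omega
    rw [hk, pow_zero, Nat.factorial_zero, Nat.cast_one, div_one, mul_one]
    refine (norm_sub_le _ _).trans ?_
    rw [norm_heisenberg (H.isSelfAdjoint_sum_term _), norm_heisenberg (H.isSelfAdjoint_sum_term _),
      two_mul]
    refine add_le_add ((norm_sum_le _ _).trans ?_) (norm_sum_le _ _)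
    exact Finset.sum_le_sum_of_subset_of_nonneg hsub fun _ _ _ => norm_nonneg _
  -- A nonzero term across the cut `AB | C` stays away from `A`.
  have hfar : ∀ X ∈ across (A ∪ B) C, H.term X ≠ 0 → ∀ x ∈ X, ∀ a ∈ A,
      regionDist A C - 2 + 1 ≤ siteDist x a := by
    intro X hX h0 x hx a ha
    simp only [across, Finset.mem_filter, Finset.mem_powerset] at hX
    obtain ⟨c, hcX, hc⟩ := Finset.not_subset.1 hX.2.1
    have hcC : c ∈ C := (Finset.mem_union.1 (hX.1 hcX)).resolve_left hc
    have h1 := regionDist_le ha hcC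
    have h2 := siteDist_triangle a x c
    have h3 := H.siteDist_le_one h0 hx hcX
    rw [siteDist_comm a x] at h2
    omega
  have hsum : ∑ X ∈ across B C, H.term X = ∑ X ∈ across (A ∪ B) C, H.term X := by
    refine Finset.sum_subset hsub fun X hX hX' => ?_
    by_contra h0
    refine hX' ?_
    have hXA : ∀ x ∈ X, x ∉ A := fun x hx ha => by
      have := hfar X hX h0 x hx x ha
      rw [siteDist_self] at this
      omega
    simp only [across, Finset.mem_filter, Finset.mem_powerset] at hX ⊢
    refine ⟨fun x hx => ?_, fun h => hX.2.1 (h.trans Finset.subset_union_right), hX.2.2⟩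
    have h1 := hX.1 hx
    rw [Finset.union_assoc, Finset.mem_union] at h1
    exact h1.resolve_left (hXA x hx)
  rw [hsum, norm_sub_rev, heisenberg_sum, heisenberg_sum, ← Finset.sum_sub_distrib, hw,
    Finset.mul_sum, Finset.sum_mul]
  refine norm_sum_le_of_le _ fun X hX => ?_
  rcases eq_or_ne (H.term X) 0 with h0 | h0
  · simp [h0, heisenberg]
  refine norm_heisenberg_sub_le H.term (fun Y => H.isHermitian Y) (fun Y Z => ¬ Disjoint Y Z)
    (fun Y Z h => (H.supportedOn Y).commute (H.supportedOn Z) (not_not.1 h))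
    (within (A ∪ B) C) (within B C) (fun k Y => ∀ y ∈ Y, ∀ a ∈ A, k + 1 ≤ siteDist y a)
    ?_ (fun Y hY F hF => H.sum_norm_overlapping_le hY F hF) _ X (hfar X hX h0) ht
  -- Passing to an overlapping term costs at most one unit of distance from A. The offset in `k + 1`
  -- keeps Z off A even at level 0, so both cut Hamiltonians treat it alike.
  intro k Y Z hY hd _ hZ
  obtain ⟨y, hyY, hyZ⟩ := Finset.not_disjoint_iff.1 hd
  have hlev : ∀ z ∈ Z, ∀ a ∈ A, k + 1 ≤ siteDist z a := by
    intro z hz a ha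
    have h1 := hY y hyY a ha
    have h2 := siteDist_triangle y z a
    have h3 := H.siteDist_le_one hZ hyZ hz
    omega
  refine ⟨hlev, ?_⟩
  simp only [within, Finset.mem_filter, Finset.mem_univ, true_and]
  refine or_congr_left ⟨fun h z hz => ?_, fun h => h.trans Finset.subset_union_right⟩
  refine (Finset.mem_union.1 (h hz)).resolve_left fun ha => ?_
  have := hlev z hz z ha
  rw [siteDist_self] at this
  omega

theorem norm_evol_decomposition_le {A B C : Finset Γ} (hAC : Disjoint A C)
    (hBC : Disjoint B C) {t : ℝ} (ht : 0 ≤ t) :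
    ‖H.evol t (A ∪ B) * (star (H.evol t B) * H.evol t (B ∪ C)) - H.evol t (A ∪ B ∪ C)‖
      ≤ 2 * t * ((2 * 2 ^ 5 ^ D * t) ^ (regionDist A C - 2) / (regionDist A C - 2).factorial)
        * H.boundaryWeight A B C := by
  rw [H.evol_mul_star_evol_mul_evol_sub hAC hBC,
    CStarRing.norm_mem_unitary_mul _ (propagator_mem_unitary (H.isSelfAdjoint_sum_term _) t)]
  have hw := H.boundaryWeight_nonneg A B C
  set b := 2 * H.boundaryWeight A B C * ((2 * 2 ^ 5 ^ D * t) ^ (regionDist A C - 2)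
          / (regionDist A C - 2).factorial) with hb
  -- The bound on the generators increases with time, so its value at the final time serves as a
  -- constant rate.
  have key := norm_interaction_sub_le (B := fun s => s * b) (B' := fun _ => b)
    (H.isSelfAdjoint_sum_term (within B C)) (H.isSelfAdjoint_sum_term (within (A ∪ B) C))
    (H.isSelfAdjoint_sum_term (across B C)) (H.isSelfAdjoint_sum_term (across (A ∪ B) C)) ht
    (by simp) (fun s => by simpa using (hasDerivAt_id s).mul_const b) fun s hs => by
      refine (H.heisenberg_across_sub_le hAC hs.1).trans ?_
      have h0 : 0 ≤ s := hs.1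
      have h1 : s ≤ t := hs.2.le
      rw [hb]
      gcongr
  refine key.trans_eq ?_
  rw [hb]
  ring

theorem inducedNorm_channel_decomposition_le {A B C : Finset Γ}
    (hAC : Disjoint A C) (hBC : Disjoint B C) (t : ℝ) :
    inducedNorm (H.channel t (A ∪ B) ∘ₗ H.channelAdj t B ∘ₗ H.channel t (B ∪ C)
        - H.channel t (A ∪ B ∪ C))
      ≤ 2 * (2 * |t| * ((2 * 2 ^ 5 ^ D * |t|) ^ (regionDist A C - 2)
          / (regionDist A C - 2).factorial) * H.boundaryWeight A B C) := by
  rw [channel, channelAdj, channel, channel, conjChannel_comp, conjChannel_comp]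
  refine (inducedNorm_conjChannel_sub_le
    (mul_mem (H.evol_mem_unitary _ _)
      (mul_mem (Unitary.star_mem (H.evol_mem_unitary _ _)) (H.evol_mem_unitary _ _)))
    (H.evol_mem_unitary _ _)).trans ?_
  refine mul_le_mul_of_nonneg_left ?_ zero_le_two
  rcases le_total 0 t with ht | ht
  · rw [abs_of_nonneg ht]
    exact H.norm_evol_decomposition_le hAC hBC ht
  · rw [abs_of_nonpos ht]
    -- Negative times reduce to positive ones by changing the sign of H, which preserves the
    -- boundary weight.
    have h := H.reverse.norm_evol_decomposition_le hAC hBC (neg_nonneg.2 ht)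
    simpa only [reverse_evol, reverse_boundaryWeight] using h

end LocalHamiltonian

/-- With k = d - 2, write x^k as (xe)^k e^{-k} and bound (xe)^k / k! by e^{xe}. Truncated
subtraction only increases k, and the shift by 2 costs e². -/
theorem pow_div_factorial_le_exp_mul_exp_neg {x : ℝ} (hx : 0 ≤ x) (d : ℕ) :
    x ^ (d - 2) / (d - 2).factorial
      ≤ Real.exp (x * Real.exp 1) * Real.exp 2 * Real.exp (-1 * (d : ℝ)) := by
  have h1 := Real.pow_div_factorial_le_exp (x * Real.exp 1) (by positivity) (d - 2)
  have h2 : (d : ℝ) - 2 ≤ ((d - 2 : ℕ) : ℝ) := by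
    rw [sub_le_iff_le_add]
    exact_mod_cast (by omega : d ≤ d - 2 + 2)
  have h3 : x ^ (d - 2) / (d - 2).factorial
      = (x * Real.exp 1) ^ (d - 2) / (d - 2).factorial * Real.exp (-((d - 2 : ℕ) : ℝ)) := by
    rw [mul_pow, ← Real.exp_nat_mul, mul_one, Real.exp_neg]
    field_simp
  rw [h3, mul_assoc (Real.exp _), ← Real.exp_add]
  gcongr
  linarith

end LocalDecomp

theorem mainTheorem5 (D : ℕ) :
    ∃ μ : ℝ, 0 < μ ∧ ∀ t : ℝ, ∃ K : ℝ, 0 ≤ K ∧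
      ∀ (q : ℕ), 1 ≤ q → ∀ (Γ : Finset (Fin D → ℤ)) (H : LocalDecomp.LocalHamiltonian Γ q)
        (A B C : Finset Γ), A.Nonempty → C.Nonempty →
        Disjoint A B → Disjoint A C → Disjoint B C →
        LocalDecomp.inducedNorm
            (H.channel t (A ∪ B) ∘ₗ H.channelAdj t B ∘ₗ H.channel t (B ∪ C)
              - H.channel t (A ∪ B ∪ C))
          ≤ K * Real.exp (-μ * (LocalDecomp.regionDist A C : ℝ)) * H.boundaryWeight A B C := by
  -- The outer 2 comes from the two sides of the conjugation, the inner 2 from the Lieb–Robinson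
  -- prefactor, and |t| from Duhamel's integral.
  refine ⟨1, one_pos, fun t => ⟨2 * (2 * |t| *
    (Real.exp (2 * 2 ^ 5 ^ D * |t| * Real.exp 1) * Real.exp 2)), by positivity, ?_⟩⟩
  intro q _ Γ H A B C _ _ _ hAC hBC
  refine (H.inducedNorm_channel_decomposition_le hAC hBC t).trans ?_
  have hw := H.boundaryWeight_nonneg A B C
  calc _ ≤ 2 * (2 * |t| * (Real.exp (2 * 2 ^ 5 ^ D * |t| * Real.exp 1) * Real.exp 2
          * Real.exp (-1 * (LocalDecomp.regionDist A C : ℝ))) * H.boundaryWeight A B C) := by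
        gcongr
        exact LocalDecomp.pow_div_factorial_le_exp_mul_exp_neg (by positivity) _
    _ = _ := by ring
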